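/- Let $m,n\ge 1$ be integers and let $\nu,\sigma,\rho\in\mathbb R$ with $\nu>m-1$ and $\sigma,\rho>0$. For $\mu\in\mathbb R^m$, a positive definite $\Sigma\in\mathbb R^{m\times m}$ and $x^n=(x_1,\dots,x_n)\in(\mathbb R^m)^n$ let $$f(x^n;\mu,\Sigma)=\frac{1}{(2\pi)^{mn/2}|\Sigma|^{n/2}}\exp\Big\{-\tfrac12\sum_{i=1}^n (x_i-\mu)^\top\Sigma^{-1}(x_i-\mu)\Big\}$$ be the density of $n$ i.i.d. observations from the $m$-dimensional normal distribution, and let $$\pi(\mu,\Sigma;\nu,\sigma^2,\rho^2)=\frac{1}{(2\pi)^{m\nu/2}|\Sigma|^{\nu/2}}\exp\Big[-\tfrac{\nu}{2}\operatorname{tr}\big\{\Sigma^{-1}(\sigma^2I_m+\rho^2\mu\mu^\top)\big\}\Big]$$ be the luckiness. Let $\mathcal M^n$ be the set of functions $x^n\mapsto f(x^n;\mu,\Sigma)\,\pi(\mu,\Sigma;\nu,\sigma^2,\rho^2)$ with $\mu\in\mathbb R^m$ and $\Sigma$ positive definite, let $C(\mathcal M^n)=\int\max_{p\in\mathcal M^n}p(x^n)\,dx^n$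 be its capacity (the integral is with respect to Lebesgue measure on $(\mathbb R^m)^n$), and let $\bar p_n(x^n)=\max_{p\in\mathcal M^n}p(x^n)/C(\mathcal M^n)$ be the normalized maximum likelihood density with luckiness (LNML density). Put $$\bar\mu_n=\frac{1}{n+\rho^2\nu}\sum_{i=1}^n x_i,\qquad \bar\Sigma_n=\frac{1}{n+\nu}\Big(\sum_{i=1}^n x_ix_i^\top+\nu\sigma^2I_m\Big)-\frac{1}{(\nu+n)(\rho^2\nu+n)}\sum_{i,j=1}^n x_ix_j^\top .$$ Let $\Gamma_m(z)=\pi^{m(m-1)/4}\prod_{j=0}^{m-1}\Gamma(z-\tfrac j2)$ be the multivariate gamma function. Then the following hold. (a) For every $x^n$ the matrix $\bar\Sigma_n$ is positive definite, and $(\bar\mu_n,\bar\Sigma_n)$ is the maximum a-posteriori (MAP) estimate under the prior proportional to $\pi$, that is, the unique maximizer of $(\mu,\Sigma)\mapsto f(x^n;\mu,\Sigma)\,\pi(\mu,\Sigma;\nu,\sigma^2,\rho^2)$ over all $\mu\in\mathbb R^m$ and all positive definite $\Sigma$. In particular the maximum over $\mathcal M^n$ exists. (b) The capacity is finite and equals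 $$C(\mathcal M^n)=\mathcal C(m,n,\nu,\sigma^2,\rho^2):=\frac{1}{\sigma^{m\nu}}\left(\frac{(n+\nu)^{n+\nu}\big(1+\frac{n}{\rho^2\nu}\big)}{(2e)^{n+\nu}(\pi\nu)^{\nu}}\right)^{m/2}\frac{\Gamma_m(\frac{\nu}{2})}{\Gamma_m(\frac{n+\nu}{2})}.$$ (c) For every $x^n$, $$\bar p_n(x^n)=\frac{f(x^n;\bar\mu_n,\bar\Sigma_n)\,\pi(\bar\mu_n,\bar\Sigma_n;\nu,\sigma^2,\rho^2)}{\mathcal C(m,n,\nu,\sigma^2,\rho^2)}=\left(\frac{\nu^\nu}{\pi^n(n+\nu)^{n+\nu}\big(1+\frac{n}{\rho^2\nu}\big)}\right)^{m/2}\frac{\Gamma_m(\frac{n+\nu}{2})}{\Gamma_m(\frac{\nu}{2})}\,\frac{\sigma^{m\nu}}{|\bar\Sigma_n|^{(n+\nu)/2}} .$$ -/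

import Mathlib

open scoped Matrix

noncomputable section

namespace LNML

/-! An unnormalized statistical model on a sample space `X` is a set `M` of functions `X → ℝ`. -/

/-- The maximal value at the sample point `x` over the (unnormalized) model `M`. -/
def maxLik {X : Type*} (M : Set (X → ℝ)) (x : X) : ℝ :=
  sSup ((fun p : X → ℝ => p x) '' M)

/-- The capacity (normalizing constant) of `M`. -/
def capacity {X : Type*} [MeasureTheory.MeasureSpace X] (M : Set (X → ℝ)) : ℝ :=
  ∫ x, maxLik M x

/-- The normalized maximum likelihood density of the (unnormalized) model `M`; if `M` consists of
densities weighted by a luckiness function, this is the LNML density. -/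
def nml {X : Type*} [MeasureTheory.MeasureSpace X] (M : Set (X → ℝ)) (x : X) : ℝ :=
  maxLik M x / capacity M

/-- The joint density of `n` i.i.d. observations from the `m`-dimensional normal distribution with
mean `μ` and covariance matrix `S`. -/
def normalDensity {m n : ℕ} (μ : Fin m → ℝ) (S : Matrix (Fin m) (Fin m) ℝ)
    (x : Fin n → Fin m → ℝ) : ℝ :=
  1 / ((2 * Real.pi) ^ ((m : ℝ) * n / 2) * S.det ^ ((n : ℝ) / 2)) *
    Real.exp (-(1 / 2) * ∑ i, (x i - μ) ⬝ᵥ (S⁻¹ *ᵥ (x i - μ)))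

/-- The luckiness function with hyperparameters `ν`, `σ ^ 2`, `ρ ^ 2`. -/
def luckiness {m : ℕ} (ν σ ρ : ℝ) (μ : Fin m → ℝ) (S : Matrix (Fin m) (Fin m) ℝ) : ℝ :=
  1 / ((2 * Real.pi) ^ ((m : ℝ) * ν / 2) * S.det ^ (ν / 2)) *
    Real.exp (-(ν / 2) *
      (S⁻¹ * (σ ^ 2 • (1 : Matrix (Fin m) (Fin m) ℝ) + ρ ^ 2 • Matrix.vecMulVec μ μ)).trace)

/-- The normal model for `n` i.i.d. observations in dimension `m`, with unknown mean and unknown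
positive definite covariance, weighted by the luckiness. -/
def normalModel (m n : ℕ) (ν σ ρ : ℝ) : Set ((Fin n → Fin m → ℝ) → ℝ) :=
  {p | ∃ (μ : Fin m → ℝ) (S : Matrix (Fin m) (Fin m) ℝ), S.PosDef ∧
    p = fun x => normalDensity μ S x * luckiness ν σ ρ μ S}

/-- The multivariate gamma function. -/
def multiGamma (m : ℕ) (z : ℝ) : ℝ :=
  Real.pi ^ ((m : ℝ) * ((m : ℝ) - 1) / 4) * ∏ j ∈ Finset.range m, Real.Gamma (z - (j : ℝ) / 2)

/-- The closed form of the capacity. -/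
def capacityFormula (m n : ℕ) (ν σ ρ : ℝ) : ℝ :=
  1 / σ ^ ((m : ℝ) * ν) *
    (((n : ℝ) + ν) ^ ((n : ℝ) + ν) * (1 + (n : ℝ) / (ρ ^ 2 * ν)) /
      ((2 * Real.exp 1) ^ ((n : ℝ) + ν) * (Real.pi * ν) ^ ν)) ^ ((m : ℝ) / 2) *
    (multiGamma m (ν / 2) / multiGamma m (((n : ℝ) + ν) / 2))

/-- The estimate of the mean. -/
def meanEst {m n : ℕ} (ν ρ : ℝ) (x : Fin n → Fin m → ℝ) : Fin m → ℝ :=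
  (1 / ((n : ℝ) + ρ ^ 2 * ν)) • ∑ i, x i

/-- The estimate of the covariance matrix. -/
def covEst {m n : ℕ} (ν σ ρ : ℝ) (x : Fin n → Fin m → ℝ) : Matrix (Fin m) (Fin m) ℝ :=
  (1 / ((n : ℝ) + ν)) •
      (∑ i, Matrix.vecMulVec (x i) (x i) + (ν * σ ^ 2) • (1 : Matrix (Fin m) (Fin m) ℝ)) -
    (1 / ((ν + n) * (ρ ^ 2 * ν + n))) • ∑ i, ∑ j, Matrix.vecMulVec (x i) (x j)

end LNML

end

noncomputable section

namespace LNML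

open Matrix

/-! ### Positive definite matrices -/

section PosDef

variable {ι : Type*} [Fintype ι] [DecidableEq ι]

/-! Maximization. Completing the square in `μ` makes `-2 log (f π)` equal to `(n + ν) (m log 2π +
log |S| + tr (S⁻¹ K)) + (n + ρ²ν) (μ - μ̄)ᵀ S⁻¹ (μ - μ̄)`, where `K = covEst` and `μ̄ = meanEst`.
The last term vanishes only at `μ = μ̄`. Since `log t ≤ t - 1` with equality only at `t = 1`,
applied to the eigenvalues of `S⁻¹ K`, the first is minimal only at `S = K`. Hence the maximum is a
constant times `|νσ² I + scatter|` to the power `-(n + ν) / 2`.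

Capacity. The observations are integrated out one at a time. A new observation changes the scatter
matrix by a rank-one term (`scatter_cons`), so the inner integral is that of a multivariate Student
kernel (`lintegral_det_add_vecMulVec_rpow`). It returns the same determinant without that
observation, with the exponent lowered by one half, exactly the form needed for induction on `n`
(`lintegral_det_add_scatter_rpow`). The Gamma quotients telescope to a quotient of multivariate
gammas. Working with `∫⁻` makes Tonelli free and yields integrability at the end. -/

theorem exists_eq_transpose_mul_self {K : Matrix ι ι ℝ} (hK : K.PosDef) :
    ∃ R : Matrix ι ι ℝ, R.det ≠ 0 ∧ K = Rᵀ * R := by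
  open scoped MatrixOrder in
  obtain ⟨R, hR, h⟩ := CStarAlgebra.isStrictlyPositive_iff_eq_star_mul_self.mp
    hK.isStrictlyPositive
  refine ⟨R, ?_, ?_⟩
  · exact ((Matrix.isUnit_iff_isUnit_det R).mp hR).ne_zero
  · rw [h, Matrix.star_eq_conjTranspose, Matrix.conjTranspose_eq_transpose_of_trivial]

theorem eq_one_of_eigenvalues_eq_one {M : Matrix ι ι ℝ} (hM : M.IsHermitian)
    (h : ∀ i, hM.eigenvalues i = 1) : M = 1 := by
  have := hM.spectral_theorem
  rw [show (RCLike.ofReal ∘ hM.eigenvalues : ι → ℝ) = fun _ => 1 by ext i; simp [h i],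
    Matrix.diagonal_one, map_one] at this
  exact this

theorem log_det_le_trace_sub_card {M : Matrix ι ι ℝ} (hM : M.PosDef) :
    Real.log M.det ≤ M.trace - Fintype.card ι := by
  rw [hM.isHermitian.det_eq_prod_eigenvalues, hM.isHermitian.trace_eq_sum_eigenvalues]
  simp only [RCLike.ofReal_real_eq_id, id]
  rw [Real.log_prod fun i _ => (hM.eigenvalues_pos i).ne']
  calc _ ≤ ∑ i, (hM.isHermitian.eigenvalues i - 1) :=
        Finset.sum_le_sum fun i _ => Real.log_le_sub_one_of_pos (hM.eigenvalues_pos i)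
    _ = _ := by simp

theorem log_det_lt_trace_sub_card {M : Matrix ι ι ℝ} (hM : M.PosDef) (h1 : M ≠ 1) :
    Real.log M.det < M.trace - Fintype.card ι := by
  rw [hM.isHermitian.det_eq_prod_eigenvalues, hM.isHermitian.trace_eq_sum_eigenvalues]
  simp only [RCLike.ofReal_real_eq_id, id]
  rw [Real.log_prod fun i _ => (hM.eigenvalues_pos i).ne']
  obtain ⟨j, hj⟩ : ∃ j, hM.isHermitian.eigenvalues j ≠ 1 := by
    by_contra! h
    exact h1 (eq_one_of_eigenvalues_eq_one hM.isHermitian h)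
  calc _ < ∑ i, (hM.isHermitian.eigenvalues i - 1) :=
        Finset.sum_lt_sum (fun i _ => Real.log_le_sub_one_of_pos (hM.eigenvalues_pos i))
          ⟨j, Finset.mem_univ j, Real.log_lt_sub_one_of_pos (hM.eigenvalues_pos j) hj⟩
    _ = _ := by simp

/-- `S⁻¹ * K` need not be symmetric. With `S⁻¹ = Rᵀ R` it is similar to the positive definite `R K
Rᵀ`, to which the eigenvalue inequalities apply. -/
theorem exists_posDef_conjugate {S K : Matrix ι ι ℝ} (hS : S.PosDef) (hK : K.PosDef) :
    ∃ M : Matrix ι ι ℝ, M.PosDef ∧ M.det = S.det⁻¹ * K.det ∧ M.trace = (S⁻¹ * K).trace ∧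
      (M = 1 → S = K) := by
  obtain ⟨R, hR, h⟩ := exists_eq_transpose_mul_self hS.inv
  have hU : IsUnit R := (Matrix.isUnit_iff_isUnit_det R).mpr hR.isUnit
  have hSu : IsUnit S.det := hS.det_pos.ne'.isUnit
  refine ⟨R * K * Rᵀ, ?_, ?_, ?_, fun h1 => ?_⟩
  · rw [← Matrix.conjTranspose_eq_transpose_of_trivial]
    exact hK.mul_mul_conjTranspose_same (Matrix.vecMul_injective_of_isUnit hU)
  · have := congrArg Matrix.det h
    rw [Matrix.det_nonsing_inv, Ring.inverse_eq_inv', Matrix.det_mul] at this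
    rw [this, Matrix.det_mul, Matrix.det_mul]
    ring
  · rw [h, Matrix.trace_mul_comm, ← Matrix.mul_assoc]
  · have h2 : K * (Rᵀ * R) = 1 := by
      rw [← Matrix.mul_assoc]
      rw [Matrix.mul_assoc] at h1
      exact mul_eq_one_comm.mp h1
    rw [← h] at h2
    have := congrArg (· * S) h2
    simpa [Matrix.mul_assoc, Matrix.nonsing_inv_mul S hSu] using this.symm

theorem log_det_sub_log_det_le {S K : Matrix ι ι ℝ} (hS : S.PosDef) (hK : K.PosDef) :
    Real.log K.det - Real.log S.det ≤ (S⁻¹ * K).trace - Fintype.card ι := by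
  obtain ⟨M, hM, hd, ht, -⟩ := exists_posDef_conjugate hS hK
  have := log_det_le_trace_sub_card hM
  rw [hd, ht, Real.log_mul (inv_ne_zero hS.det_pos.ne') hK.det_pos.ne', Real.log_inv] at this
  linarith

theorem log_det_sub_log_det_lt {S K : Matrix ι ι ℝ} (hS : S.PosDef) (hK : K.PosDef)
    (h : S ≠ K) : Real.log K.det - Real.log S.det < (S⁻¹ * K).trace - Fintype.card ι := by
  obtain ⟨M, hM, hd, ht, h1⟩ := exists_posDef_conjugate hS hK
  have := log_det_lt_trace_sub_card hM fun h' => h (h1 h')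
  rw [hd, ht, Real.log_mul (inv_ne_zero hS.det_pos.ne') hK.det_pos.ne', Real.log_inv] at this
  linarith

theorem det_add_vecMulVec {K : Matrix ι ι ℝ} (hK : K.PosDef) (u v : ι → ℝ) :
    (K + vecMulVec u v).det = K.det * (1 + v ⬝ᵥ (K⁻¹ *ᵥ u)) := by
  rw [vecMulVec_eq Unit, det_add_replicateCol_mul_replicateRow hK.det_pos.ne'.isUnit]
  congr 1
  rw [det_unique, Matrix.mul_assoc]
  simp [Matrix.mul_apply, dotProduct, mulVec, replicateRow, replicateCol]

omit [DecidableEq ι] in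
theorem trace_mul_vecMulVec (S : Matrix ι ι ℝ) (u v : ι → ℝ) :
    (S * vecMulVec u v).trace = v ⬝ᵥ (S *ᵥ u) := by
  rw [mul_vecMulVec, trace_vecMulVec, dotProduct_comm]

omit [DecidableEq ι] in
theorem posSemidef_vecMulVec_self (v : ι → ℝ) : (vecMulVec v v).PosSemidef := by
  simpa using posSemidef_vecMulVec_self_star v

end PosDef

/-! ### The scatter matrix -/

/-- The shrunken scatter matrix of `x`. -/
def scatter {m n : ℕ} (c : ℝ) (x : Fin n → Fin m → ℝ) : Matrix (Fin m) (Fin m) ℝ :=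
  ∑ i, vecMulVec (x i) (x i) - (c + n)⁻¹ • vecMulVec (∑ i, x i) (∑ i, x i)

/-- `scatter c x` is the centred scatter of `x` together with pseudo-observations at the origin of
total weight `c`, so this is the usual one-point update around the old mean `(c + n)⁻¹ • ∑ i, x i`.
It gives both positive semidefiniteness and the recursion for the capacity. -/
theorem scatter_cons {m n : ℕ} {c : ℝ} (hc : 0 < c) (y : Fin m → ℝ) (x : Fin n → Fin m → ℝ) :
    scatter c (Fin.cons y x : Fin (n + 1) → Fin m → ℝ) = scatter c x +
      ((c + n) / (c + n + 1)) • vecMulVec (y - (c + n)⁻¹ • ∑ i, x i) (y - (c + n)⁻¹ • ∑ i, x i) := by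
  have h1 : c + n ≠ 0 := by positivity
  have h2 : c + n + 1 ≠ 0 := by positivity
  ext a b
  simp only [scatter, Fin.sum_univ_succ, Fin.cons_zero, Fin.cons_succ, Matrix.sub_apply,
    Matrix.add_apply, Matrix.smul_apply, vecMulVec_apply, Pi.add_apply, Pi.sub_apply,
    Pi.smul_apply, smul_eq_mul]
  push_cast
  rw [← add_assoc]
  field_simp
  ring

theorem scatter_posSemidef {m : ℕ} {c : ℝ} (hc : 0 < c) :
    ∀ {n : ℕ} (x : Fin n → Fin m → ℝ), (scatter c x).PosSemidef
  | 0, x => by simpa [scatter] using PosSemidef.zero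
  | n + 1, x => by
    rw [← Fin.cons_self_tail x, scatter_cons hc]
    exact (scatter_posSemidef hc _).add ((posSemidef_vecMulVec_self _).smul (by positivity))

theorem covEst_eq {m n : ℕ} {ν σ ρ : ℝ} (x : Fin n → Fin m → ℝ) :
    covEst ν σ ρ x = (n + ν)⁻¹ • ((ν * σ ^ 2) • (1 : Matrix (Fin m) (Fin m) ℝ) +
      scatter (ρ ^ 2 * ν) x) := by
  have h : ∑ i, ∑ j, vecMulVec (x i) (x j) = vecMulVec (∑ i, x i) (∑ i, x i) := by
    ext a b
    simp [vecMulVec_apply, Matrix.sum_apply, Finset.sum_mul_sum]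
  rw [covEst, h, scatter]
  ext a b
  simp only [Matrix.sub_apply, Matrix.add_apply, Matrix.smul_apply, smul_eq_mul]
  rw [one_div, one_div, mul_inv, add_comm ν]
  ring

theorem posDef_add_scatter {m n : ℕ} {c : ℝ} (hc : 0 < c) {K : Matrix (Fin m) (Fin m) ℝ}
    (hK : K.PosDef) (x : Fin n → Fin m → ℝ) : (K + scatter c x).PosDef :=
  hK.add_posSemidef (scatter_posSemidef hc x)

theorem covEst_posDef {m n : ℕ} {ν σ ρ : ℝ} (hν : 0 < ν) (hσ : 0 < σ) (hρ : 0 < ρ)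
    (x : Fin n → Fin m → ℝ) : (covEst ν σ ρ x).PosDef := by
  rw [covEst_eq]
  exact (posDef_add_scatter (by positivity) (PosDef.one.smul (by positivity)) x).smul
    (by positivity)

/-! ### The weighted likelihood -/

/-- Completing the square in `μ` at the level of matrices; the trace against `S⁻¹` then gives the
exponent of the weighted likelihood. -/
theorem sum_vecMulVec_sub_add {m n : ℕ} {ν σ ρ : ℝ} (hν : 0 < ν) (hρ : 0 < ρ)
    (μ : Fin m → ℝ) (x : Fin n → Fin m → ℝ) :
    ∑ i, vecMulVec (x i - μ) (x i - μ) +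
        ν • (σ ^ 2 • (1 : Matrix (Fin m) (Fin m) ℝ) + ρ ^ 2 • vecMulVec μ μ) =
      (n + ν) • covEst ν σ ρ x +
        (n + ρ ^ 2 * ν) • vecMulVec (μ - meanEst ν ρ x) (μ - meanEst ν ρ x) := by
  have h1 : (n : ℝ) + ν ≠ 0 := by positivity
  have h2 : (n : ℝ) + ρ ^ 2 * ν ≠ 0 := by positivity
  rw [covEst_eq, smul_smul, mul_inv_cancel₀ h1, one_smul, scatter, meanEst]
  ext a b
  simp only [Matrix.sub_apply, Matrix.add_apply, Matrix.smul_apply, smul_eq_mul,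
    Matrix.sum_apply, vecMulVec_apply, Pi.sub_apply, Pi.smul_apply, Finset.sum_apply,
    sub_mul, mul_sub, Finset.sum_sub_distrib, ← Finset.sum_mul, ← Finset.mul_sum,
    Finset.sum_const, Finset.card_univ, Fintype.card_fin, nsmul_eq_mul]
  rw [add_comm (ρ ^ 2 * ν)]
  field_simp
  ring

theorem normalDensity_mul_luckiness {m n : ℕ} {ν σ ρ : ℝ} (hν : 0 < ν) (hρ : 0 < ρ)
    (μ : Fin m → ℝ) {S : Matrix (Fin m) (Fin m) ℝ} (hS : S.PosDef) (x : Fin n → Fin m → ℝ) :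
    normalDensity μ S x * luckiness ν σ ρ μ S =
      Real.exp (-((n + ν) / 2) * (m * Real.log (2 * Real.pi) + Real.log S.det +
        (S⁻¹ * covEst ν σ ρ x).trace) -
          (n + ρ ^ 2 * ν) / 2 * ((μ - meanEst ν ρ x) ⬝ᵥ (S⁻¹ *ᵥ (μ - meanEst ν ρ x)))) := by
  have h := congrArg (fun A => (S⁻¹ * A).trace) (sum_vecMulVec_sub_add (σ := σ) hν hρ μ x)
  simp only [Matrix.mul_add, Matrix.mul_sum, Matrix.trace_add, Matrix.trace_sum,
    Matrix.mul_smul, Matrix.trace_smul, trace_mul_vecMulVec, smul_eq_mul] at h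
  have hd := hS.det_pos
  rw [normalDensity, luckiness, Real.rpow_def_of_pos (by positivity), Real.rpow_def_of_pos hd,
    Real.rpow_def_of_pos (by positivity), Real.rpow_def_of_pos hd, ← Real.exp_add,
    ← Real.exp_add, one_div (Real.exp _), one_div (Real.exp _), ← Real.exp_neg, ← Real.exp_neg, ← Real.exp_add,
    ← Real.exp_add, ← Real.exp_add, Real.exp_eq_exp]
  simp only [Matrix.mul_add, Matrix.mul_smul, Matrix.trace_add, Matrix.trace_smul,
    trace_mul_vecMulVec, smul_eq_mul]
  linear_combination (-1 / 2) * h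

theorem normalDensity_mul_luckiness_map {m n : ℕ} {ν σ ρ : ℝ} (hν : 0 < ν) (hσ : 0 < σ)
    (hρ : 0 < ρ) (x : Fin n → Fin m → ℝ) :
    normalDensity (meanEst ν ρ x) (covEst ν σ ρ x) x *
        luckiness ν σ ρ (meanEst ν ρ x) (covEst ν σ ρ x) =
      Real.exp (-((n + ν) / 2) * (m * Real.log (2 * Real.pi) + Real.log (covEst ν σ ρ x).det +
        m)) := by
  have hK := covEst_posDef hν hσ hρ x
  rw [normalDensity_mul_luckiness hν hρ _ hK, Matrix.nonsing_inv_mul _ hK.det_pos.ne'.isUnit]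
  simp

theorem normalDensity_mul_luckiness_lt {m n : ℕ} {ν σ ρ : ℝ} (hν : 0 < ν) (hσ : 0 < σ)
    (hρ : 0 < ρ) (x : Fin n → Fin m → ℝ) (μ : Fin m → ℝ) {S : Matrix (Fin m) (Fin m) ℝ}
    (hS : S.PosDef) (hne : (μ, S) ≠ (meanEst ν ρ x, covEst ν σ ρ x)) :
    normalDensity μ S x * luckiness ν σ ρ μ S <
      normalDensity (meanEst ν ρ x) (covEst ν σ ρ x) x *
        luckiness ν σ ρ (meanEst ν ρ x) (covEst ν σ ρ x) := by
  have hK := covEst_posDef hν hσ hρ x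
  rw [normalDensity_mul_luckiness_map hν hσ hρ, normalDensity_mul_luckiness hν hρ _ hS,
    Real.exp_lt_exp]
  have hs : 0 < ((n : ℝ) + ν) / 2 := by positivity
  have hc : 0 < ((n : ℝ) + ρ ^ 2 * ν) / 2 := by positivity
  -- Strictness comes from the quadratic form in `μ` when the covariances agree, and from the
  -- log-determinant inequality otherwise.
  by_cases hSK : S = covEst ν σ ρ x
  · have hμ : μ - meanEst ν ρ x ≠ 0 := fun h => hne (by rw [sub_eq_zero.mp h, hSK])
    have h1 := hS.inv.dotProduct_mulVec_pos hμ
    rw [star_trivial] at h1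
    have h2 := log_det_sub_log_det_le hS hK
    rw [Fintype.card_fin] at h2
    nlinarith [mul_pos hc h1, mul_le_mul_of_nonneg_left h2 hs.le]
  · have h1 := hS.inv.posSemidef.dotProduct_mulVec_nonneg (μ - meanEst ν ρ x)
    rw [star_trivial] at h1
    have h2 := log_det_sub_log_det_lt hS hK hSK
    rw [Fintype.card_fin] at h2
    nlinarith [mul_nonneg hc.le h1, mul_lt_mul_of_pos_left h2 hs]

theorem isGreatest_normalModel {m n : ℕ} {ν σ ρ : ℝ} (hν : 0 < ν) (hσ : 0 < σ)
    (hρ : 0 < ρ) (x : Fin n → Fin m → ℝ) :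
    IsGreatest ((fun p : (Fin n → Fin m → ℝ) → ℝ => p x) '' normalModel m n ν σ ρ)
      (normalDensity (meanEst ν ρ x) (covEst ν σ ρ x) x *
        luckiness ν σ ρ (meanEst ν ρ x) (covEst ν σ ρ x)) := by
  refine ⟨⟨_, ⟨meanEst ν ρ x, covEst ν σ ρ x, covEst_posDef hν hσ hρ x, rfl⟩, rfl⟩, ?_⟩
  rintro _ ⟨_, ⟨μ, S, hS, rfl⟩, rfl⟩
  by_cases h : (μ, S) = (meanEst ν ρ x, covEst ν σ ρ x)
  · obtain ⟨rfl, rfl⟩ := Prod.mk.inj h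
    exact le_rfl
  · exact (normalDensity_mul_luckiness_lt hν hσ hρ x μ hS h).le

/-! ### The integral of a multivariate Student kernel -/

open MeasureTheory in
theorem lintegral_ofReal_of_integral_eq {α : Type*} [MeasurableSpace α] {μ : Measure α}
    {f : α → ℝ} {A : ℝ} (hf : 0 ≤ᵐ[μ] f) (hA : A ≠ 0) (h : ∫ a, f a ∂μ = A) :
    ∫⁻ a, ENNReal.ofReal (f a) ∂μ = ENNReal.ofReal A := by
  -- A non-integrable function has Bochner integral zero, so a nonzero value already forces
  -- integrability.
  rw [← ofReal_integral_eq_lintegral_ofReal (Integrable.of_integral_ne_zero (h ▸ hA)) hf, h]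

theorem lintegral_exp_neg_mul_dotProduct_self (m : ℕ) {b : ℝ} (hb : 0 < b) :
    ∫⁻ z : Fin m → ℝ, ENNReal.ofReal (Real.exp (-(b * (z ⬝ᵥ z)))) =
      ENNReal.ofReal ((Real.pi / b) ^ ((m : ℝ) / 2)) := by
  refine lintegral_ofReal_of_integral_eq (.of_forall fun z => (Real.exp_pos _).le)
    (by positivity) ?_
  have h := GaussianFourier.integral_rexp_neg_mul_sq_norm (V := EuclideanSpace ℝ (Fin m)) hb
  rw [← (PiLp.volume_preserving_toLp (Fin m)).integral_comp
    (MeasurableEquiv.toLp 2 (Fin m → ℝ)).measurableEmbedding] at h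
  simp only [finrank_euclideanSpace_fin, EuclideanSpace.real_norm_sq_eq] at h
  rw [← h]
  simp [dotProduct, sq]

theorem lintegral_rpow_mul_exp_neg_mul {a r : ℝ} (ha : 0 < a) (hr : 0 < r) :
    ∫⁻ t in Set.Ioi (0 : ℝ), ENNReal.ofReal (t ^ (a - 1) * Real.exp (-(r * t))) =
      ENNReal.ofReal (r ^ (-a) * Real.Gamma a) := by
  have hG := Real.Gamma_pos_of_pos ha
  refine lintegral_ofReal_of_integral_eq ?_ (by positivity) ?_
  · filter_upwards [MeasureTheory.self_mem_ae_restrict measurableSet_Ioi] with t ht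
    have : 0 < t := ht
    simp only [Pi.zero_apply]
    positivity
  · rw [Real.integral_rpow_mul_exp_neg_mul_Ioi ha hr, one_div, Real.inv_rpow hr.le,
      Real.rpow_neg hr.le]

/-- The Student kernel is a Gamma mixture of Gaussians: write the power as a Gamma integral over
`t`, swap, and integrate the Gaussian in `z`. Its factor `(π / t) ^ (m / 2)` leaves a Gamma integral
of parameter `(s - m) / 2`, positive by `hs`. -/
theorem lintegral_one_add_dotProduct_self_rpow {m : ℕ} {s : ℝ} (hs : (m : ℝ) < s) :
    ∫⁻ z : Fin m → ℝ, ENNReal.ofReal ((1 + z ⬝ᵥ z) ^ (-(s / 2))) =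
      ENNReal.ofReal (Real.pi ^ ((m : ℝ) / 2) *
        (Real.Gamma ((s - m) / 2) / Real.Gamma (s / 2))) := by
  have hm : (0 : ℝ) ≤ m := m.cast_nonneg
  have hs0 : 0 < s / 2 := by linarith
  have hG := Real.Gamma_pos_of_pos hs0
  have hq (z : Fin m → ℝ) : 0 ≤ z ⬝ᵥ z := by simpa using dotProduct_star_self_nonneg z
  have h1 (z : Fin m → ℝ) : ENNReal.ofReal ((1 + z ⬝ᵥ z) ^ (-(s / 2))) =
      ENNReal.ofReal (Real.Gamma (s / 2))⁻¹ * ∫⁻ t in Set.Ioi (0 : ℝ),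
        ENNReal.ofReal (t ^ (s / 2 - 1) * Real.exp (-((1 + z ⬝ᵥ z) * t))) := by
    rw [lintegral_rpow_mul_exp_neg_mul hs0 (by linarith [hq z]),
      ← ENNReal.ofReal_mul (by positivity)]
    congr 1
    field_simp
  have hmeas : Measurable (fun p : (Fin m → ℝ) × ℝ =>
      ENNReal.ofReal (p.2 ^ (s / 2 - 1) * Real.exp (-((1 + p.1 ⬝ᵥ p.1) * p.2)))) := by
    simp only [dotProduct]
    fun_prop
  simp_rw [h1]
  rw [MeasureTheory.lintegral_const_mul' _ _ ENNReal.ofReal_ne_top,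
    MeasureTheory.lintegral_lintegral_swap hmeas.aemeasurable]
  have h2 : ∀ t ∈ Set.Ioi (0 : ℝ), ∫⁻ z : Fin m → ℝ,
      ENNReal.ofReal (t ^ (s / 2 - 1) * Real.exp (-((1 + z ⬝ᵥ z) * t))) =
      ENNReal.ofReal (Real.pi ^ ((m : ℝ) / 2)) *
        ENNReal.ofReal (t ^ ((s - m) / 2 - 1) * Real.exp (-(1 * t))) := by
    intro t ht
    have ht : 0 < t := ht
    have h3 (z : Fin m → ℝ) :
        ENNReal.ofReal (t ^ (s / 2 - 1) * Real.exp (-((1 + z ⬝ᵥ z) * t))) =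
        ENNReal.ofReal (t ^ (s / 2 - 1) * Real.exp (-t)) *
          ENNReal.ofReal (Real.exp (-(t * (z ⬝ᵥ z)))) := by
      rw [← ENNReal.ofReal_mul (by positivity), mul_assoc, ← Real.exp_add]
      ring_nf
    simp_rw [h3]
    rw [MeasureTheory.lintegral_const_mul' _ _ ENNReal.ofReal_ne_top,
      lintegral_exp_neg_mul_dotProduct_self m ht, ← ENNReal.ofReal_mul (by positivity),
      ← ENNReal.ofReal_mul (by positivity), Real.div_rpow Real.pi_pos.le ht.le,
      show (s - m) / 2 - 1 = (s / 2 - 1) - m / 2 by ring, Real.rpow_sub ht _ ((m : ℝ) / 2), one_mul]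
    congr 1
    ring
  rw [MeasureTheory.setLIntegral_congr_fun measurableSet_Ioi h2,
    MeasureTheory.lintegral_const_mul' _ _ ENNReal.ofReal_ne_top,
    lintegral_rpow_mul_exp_neg_mul (by linarith) one_pos, Real.one_rpow, one_mul,
    ← ENNReal.ofReal_mul (by positivity), ← ENNReal.ofReal_mul (by positivity)]
  congr 1
  ring

theorem lintegral_comp_mulVec {m : ℕ} {R : Matrix (Fin m) (Fin m) ℝ} (hR : R.det ≠ 0)
    {f : (Fin m → ℝ) → ENNReal} (hf : Measurable f) :
    ∫⁻ z, f (R *ᵥ z) = ENNReal.ofReal |R.det|⁻¹ * ∫⁻ z, f z := by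
  have h := Real.map_matrix_volume_pi_eq_smul_volume_pi hR
  have hm : Measurable (toLin' R) :=
    (LinearMap.continuous_of_finiteDimensional (toLin' R)).measurable
  have := MeasureTheory.lintegral_map (μ := MeasureTheory.volume) hf hm
  rw [h, MeasureTheory.lintegral_smul_measure] at this
  simpa [abs_inv] using this.symm

/-- After translation the matrix determinant lemma gives `|K| (1 + α yᵀ K⁻¹ y)`, and with `K⁻¹ = Rᵀ
R` the substitution `z = √α R y` reduces to the standard kernel. The Jacobian contributes `|K| ^ (1
/ 2)`, which turns the exponent `-s / 2` into `-(s - 1) / 2`. -/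
theorem lintegral_det_add_vecMulVec_rpow {m : ℕ} {s α : ℝ} (hs : (m : ℝ) < s) (hα : 0 < α)
    {K : Matrix (Fin m) (Fin m) ℝ} (hK : K.PosDef) (u : Fin m → ℝ) :
    ∫⁻ y : Fin m → ℝ, ENNReal.ofReal
        ((K + α • vecMulVec (y - u) (y - u)).det ^ (-(s / 2))) =
      ENNReal.ofReal ((Real.pi / α) ^ ((m : ℝ) / 2) *
        (Real.Gamma ((s - m) / 2) / Real.Gamma (s / 2)) * K.det ^ (-((s - 1) / 2))) := by
  rw [MeasureTheory.lintegral_sub_right_eq_self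
    (fun y => ENNReal.ofReal ((K + α • vecMulVec y y).det ^ (-(s / 2)))) u]
  obtain ⟨R, hR, h⟩ := exists_eq_transpose_mul_self hK.inv
  have hd := hK.det_pos
  have hdet : |R.det| = K.det ^ (-(1 / 2) : ℝ) := by
    have := congrArg Matrix.det h
    rw [Matrix.det_nonsing_inv, Ring.inverse_eq_inv', Matrix.det_mul, Matrix.det_transpose,
      ← sq] at this
    rw [← Real.sqrt_sq_eq_abs, ← this, Real.sqrt_eq_rpow, ← Real.rpow_neg_one,
      ← Real.rpow_mul hd.le]
    norm_num
  have hT : (√α • R).det ≠ 0 := by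
    rw [Matrix.det_smul]
    have := Real.sqrt_pos.mpr hα
    positivity
  have hTdet : |(√α • R).det|⁻¹ = α ^ (-((m : ℝ) / 2)) * K.det ^ ((1 : ℝ) / 2) := by
    rw [Matrix.det_smul, abs_mul, hdet, Fintype.card_fin, abs_of_nonneg (by positivity), mul_inv,
      ← Real.rpow_neg hd.le, Real.sqrt_eq_rpow, ← Real.rpow_natCast, ← Real.rpow_mul hα.le,
      ← Real.rpow_neg hα.le]
    ring_nf
  have hq (y : Fin m → ℝ) : 0 ≤ y ⬝ᵥ y := by simpa using dotProduct_star_self_nonneg y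
  have h1 (y : Fin m → ℝ) : ENNReal.ofReal ((K + α • vecMulVec y y).det ^ (-(s / 2))) =
      ENNReal.ofReal (K.det ^ (-(s / 2))) *
        ENNReal.ofReal ((1 + ((√α • R) *ᵥ y) ⬝ᵥ ((√α • R) *ᵥ y)) ^ (-(s / 2))) := by
    have h2 : ((√α • R) *ᵥ y) ⬝ᵥ ((√α • R) *ᵥ y) = y ⬝ᵥ (K⁻¹ *ᵥ (α • y)) := by
      rw [h, ← mulVec_mulVec, dotProduct_mulVec y, vecMul_transpose, smul_mulVec, mulVec_smul,
        smul_dotProduct, dotProduct_smul, dotProduct_smul, smul_smul, Real.mul_self_sqrt hα.le]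
    rw [← smul_vecMulVec, det_add_vecMulVec hK, ← h2,
      Real.mul_rpow hd.le (by linarith [hq ((√α • R) *ᵥ y)]), ENNReal.ofReal_mul (by positivity)]
  simp_rw [h1]
  have hmeas : Measurable fun z : Fin m → ℝ =>
      ENNReal.ofReal ((1 + z ⬝ᵥ z) ^ (-(s / 2))) := by
    simp only [dotProduct]
    fun_prop
  rw [MeasureTheory.lintegral_const_mul' _ _ ENNReal.ofReal_ne_top,
    lintegral_comp_mulVec hT hmeas, lintegral_one_add_dotProduct_self_rpow hs, hTdet,
    ← ENNReal.ofReal_mul (by positivity), ← ENNReal.ofReal_mul (by positivity)]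
  congr 1
  rw [Real.div_rpow Real.pi_pos.le hα.le, Real.rpow_neg hα.le,
    show -((s - 1) / 2) = -(s / 2) + 1 / 2 by ring, Real.rpow_add hd]
  ring

/-! ### The capacity -/

theorem multiGamma_pos {m : ℕ} {z : ℝ} (hz : (m : ℝ) - 1 < 2 * z) : 0 < multiGamma m z := by
  refine mul_pos (Real.rpow_pos_of_pos Real.pi_pos _) (Finset.prod_pos fun j hj => ?_)
  have : (j : ℝ) + 1 ≤ m := by exact_mod_cast Finset.mem_range.mp hj
  exact Real.Gamma_pos_of_pos (by linarith)

/-- The arguments descend in steps of one half, so both sides are the same product of `m + 1` Gamma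
values, split at its last or its first factor. -/
theorem multiGamma_add_half_mul_Gamma (m : ℕ) (z : ℝ) :
    multiGamma m (z + 1 / 2) * Real.Gamma (z + 1 / 2 - m / 2) =
      multiGamma m z * Real.Gamma (z + 1 / 2) := by
  have h1 := Finset.prod_range_succ (fun j : ℕ => Real.Gamma (z + 1 / 2 - (j : ℝ) / 2)) m
  have h2 := Finset.prod_range_succ' (fun j : ℕ => Real.Gamma (z + 1 / 2 - (j : ℝ) / 2)) m
  have h3 : ∀ j : ℕ, z + 1 / 2 - ((j + 1 : ℕ) : ℝ) / 2 = z - j / 2 := by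
    intro j; push_cast; ring
  simp only [h3, Nat.cast_zero, zero_div, sub_zero] at h2
  rw [multiGamma, multiGamma, mul_assoc, ← h1, h2, mul_assoc]

theorem continuous_scatter {m n : ℕ} (c : ℝ) :
    Continuous (scatter c : (Fin n → Fin m → ℝ) → Matrix (Fin m) (Fin m) ℝ) := by
  have hsum : Continuous fun x : Fin n → Fin m → ℝ => ∑ i, x i := by fun_prop
  unfold scatter
  refine Continuous.sub (continuous_finsetSum _ fun i _ => ?_) ?_
  · exact (continuous_apply i).matrix_vecMulVec (continuous_apply i)
  · exact (hsum.matrix_vecMulVec hsum).const_smul (c + n)⁻¹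

theorem lintegral_pi_succ {m n : ℕ} {f : (Fin (n + 1) → Fin m → ℝ) → ENNReal}
    (hf : Measurable f) :
    ∫⁻ x, f x = ∫⁻ x : Fin n → Fin m → ℝ, ∫⁻ y : Fin m → ℝ, f (Fin.cons y x) := by
  have h := (MeasureTheory.volume_preserving_piFinSuccAbove
    (fun _ : Fin (n + 1) => Fin m → ℝ) 0).symm
  rw [← h.lintegral_comp_emb (MeasurableEquiv.measurableEmbedding _) f]
  refine (MeasureTheory.lintegral_prod_symm _ ?_).trans ?_
  · exact (hf.comp (MeasurableEquiv.measurable _)).aemeasurable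
  · refine MeasureTheory.lintegral_congr fun x => MeasureTheory.lintegral_congr fun y =>
      congrArg f ?_
    exact Fin.insertNth_zero' y x

theorem measurable_det_add_scatter_rpow {m n : ℕ} (c r : ℝ) (K : Matrix (Fin m) (Fin m) ℝ) :
    Measurable fun x : Fin n → Fin m → ℝ => (K + scatter c x).det ^ r :=
  ((continuous_const.add (continuous_scatter c)).matrix_det.measurable).pow_const r

theorem lintegral_det_add_scatter_rpow {m : ℕ} {ν c : ℝ} (hν : (m : ℝ) - 1 < ν) (hν0 : 0 < ν)
    (hc : 0 < c) {K : Matrix (Fin m) (Fin m) ℝ} (hK : K.PosDef) (n : ℕ) :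
    ∫⁻ x : Fin n → Fin m → ℝ, ENNReal.ofReal ((K + scatter c x).det ^ (-((n + ν) / 2))) =
      ENNReal.ofReal ((Real.pi ^ (n : ℝ) * (1 + n / c)) ^ ((m : ℝ) / 2) *
        (multiGamma m (ν / 2) / multiGamma m ((n + ν) / 2)) * K.det ^ (-(ν / 2))) := by
  induction n with
  | zero =>
    have hG := multiGamma_pos (m := m) (z := ν / 2) (by linarith)
    simp [scatter, div_self hG.ne', MeasureTheory.volume_pi]
  | succ n ih =>
    have hn : (0 : ℝ) ≤ n := n.cast_nonneg
    -- The Student integral needs `m < s`, which follows from `m - 1 < ν`; and `s - 1 = n + ν` is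
    -- the exponent in the induction hypothesis.
    set s : ℝ := ((n + 1 : ℕ) : ℝ) + ν with hs
    have hs' : s = n + ν + 1 := by rw [hs]; push_cast; ring
    have hα : 0 < (c + n) / (c + n + 1) := by positivity
    rw [lintegral_pi_succ (measurable_det_add_scatter_rpow c _ K).ennreal_ofReal]
    simp_rw [scatter_cons hc, ← add_assoc]
    simp_rw [fun x : Fin n → Fin m → ℝ => lintegral_det_add_vecMulVec_rpow (s := s)
      (by rw [hs']; linarith) hα (posDef_add_scatter hc hK x) ((c + n)⁻¹ • ∑ i, x i)]
    have hG1 := Real.Gamma_pos_of_pos (s := (s - m) / 2) (by rw [hs']; linarith)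
    have hG2 := Real.Gamma_pos_of_pos (s := s / 2) (by rw [hs']; linarith)
    have hM1 := multiGamma_pos (m := m) (z := s / 2) (by rw [hs']; linarith)
    have hM2 := multiGamma_pos (m := m) (z := (n + ν) / 2) (by linarith)
    have hM3 := multiGamma_pos (m := m) (z := ν / 2) (by linarith)
    have h1 (x : Fin n → Fin m → ℝ) := ENNReal.ofReal_mul
      (p := (Real.pi / ((c + n) / (c + n + 1))) ^ ((m : ℝ) / 2) *
        (Real.Gamma ((s - m) / 2) / Real.Gamma (s / 2)))
      (q := (K + scatter c x).det ^ (-((s - 1) / 2))) (by positivity)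
    simp_rw [h1, show s - 1 = n + ν by rw [hs']; ring]
    rw [MeasureTheory.lintegral_const_mul' _ _ ENNReal.ofReal_ne_top, ih,
      ← ENNReal.ofReal_mul (by positivity)]
    congr 1
    have h2 := multiGamma_add_half_mul_Gamma m ((n + ν) / 2)
    rw [show (n + ν) / 2 + 1 / 2 = s / 2 by rw [hs']; ring,
      show s / 2 - m / 2 = (s - m) / 2 by ring] at h2
    have h3 : Real.Gamma ((s - m) / 2) / Real.Gamma (s / 2) =
        multiGamma m ((n + ν) / 2) / multiGamma m (s / 2) := by
      rw [div_eq_div_iff hG2.ne' hM1.ne', ← h2]; ring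
    -- The weights `(c + n + 1) / (c + n)` telescope to `1 + n / c`.
    have h4 : Real.pi ^ ((n + 1 : ℕ) : ℝ) * (1 + ((n + 1 : ℕ) : ℝ) / c) =
        Real.pi / ((c + n) / (c + n + 1)) * (Real.pi ^ (n : ℝ) * (1 + n / c)) := by
      rw [Real.rpow_natCast, Real.rpow_natCast, pow_succ]
      have : c + n ≠ 0 := by positivity
      push_cast
      field_simp
      ring
    rw [h3, h4, Real.mul_rpow (x := Real.pi / ((c + n) / (c + n + 1))) (by positivity) (by positivity)]
    generalize (Real.pi / ((c + n) / (c + n + 1))) ^ ((m : ℝ) / 2) = A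
    generalize (Real.pi ^ (n : ℝ) * (1 + n / c)) ^ ((m : ℝ) / 2) = B
    field_simp

theorem maxLik_normalModel {m n : ℕ} {ν σ ρ : ℝ} (hν : 0 < ν) (hσ : 0 < σ)
    (hρ : 0 < ρ) (x : Fin n → Fin m → ℝ) :
    maxLik (normalModel m n ν σ ρ) x = normalDensity (meanEst ν ρ x) (covEst ν σ ρ x) x *
      luckiness ν σ ρ (meanEst ν ρ x) (covEst ν σ ρ x) :=
  (isGreatest_normalModel hν hσ hρ x).csSup_eq

theorem maxLik_normalModel_eq_rpow {m n : ℕ} {ν σ ρ : ℝ} (hν : 0 < ν) (hσ : 0 < σ)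
    (hρ : 0 < ρ) (x : Fin n → Fin m → ℝ) :
    maxLik (normalModel m n ν σ ρ) x =
      Real.exp (-((n + ν) / 2) * (m * (Real.log (2 * Real.pi) + 1 - Real.log (n + ν)))) *
        ((ν * σ ^ 2) • (1 : Matrix (Fin m) (Fin m) ℝ) + scatter (ρ ^ 2 * ν) x).det ^
          (-((n + ν) / 2)) := by
  have hK : ((ν * σ ^ 2) • (1 : Matrix (Fin m) (Fin m) ℝ) + scatter (ρ ^ 2 * ν) x).PosDef :=
    posDef_add_scatter (by positivity) (PosDef.one.smul (by positivity)) x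
  have hs : 0 < (n : ℝ) + ν := by positivity
  have hd := hK.det_pos
  rw [maxLik_normalModel hν hσ hρ, normalDensity_mul_luckiness_map hν hσ hρ, covEst_eq,
    Matrix.det_smul, Fintype.card_fin, Real.log_mul (by positivity) hd.ne', Real.log_pow,
    Real.log_inv, Real.rpow_def_of_pos hd, ← Real.exp_add]
  ring_nf

theorem capacityFormula_eq {m n : ℕ} {ν σ ρ : ℝ} (hν : 0 < ν) (hσ : 0 < σ) (hρ : 0 < ρ) :
    capacityFormula m n ν σ ρ =
      Real.exp (-((n + ν) / 2) * (m * (Real.log (2 * Real.pi) + 1 - Real.log (n + ν)))) *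
      ((Real.pi ^ (n : ℝ) * (1 + n / (ρ ^ 2 * ν))) ^ ((m : ℝ) / 2) *
        (multiGamma m (ν / 2) / multiGamma m ((n + ν) / 2)) *
        ((ν * σ ^ 2) • (1 : Matrix (Fin m) (Fin m) ℝ)).det ^ (-(ν / 2))) := by
  have hs : 0 < (n : ℝ) + ν := by positivity
  have hc : 0 < 1 + (n : ℝ) / (ρ ^ 2 * ν) := by positivity
  have hπ := Real.pi_pos
  have h2π : Real.log (2 * Real.pi) = Real.log 2 + Real.log Real.pi :=
    Real.log_mul two_ne_zero hπ.ne'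
  have h : 1 / σ ^ ((m : ℝ) * ν) *
      (((n : ℝ) + ν) ^ ((n : ℝ) + ν) * (1 + (n : ℝ) / (ρ ^ 2 * ν)) /
        ((2 * Real.exp 1) ^ ((n : ℝ) + ν) * (Real.pi * ν) ^ ν)) ^ ((m : ℝ) / 2) =
      Real.exp (-((n + ν) / 2) * (m * (Real.log (2 * Real.pi) + 1 - Real.log (n + ν)))) *
      (Real.pi ^ (n : ℝ) * (1 + n / (ρ ^ 2 * ν))) ^ ((m : ℝ) / 2) *
        ((ν * σ ^ 2) • (1 : Matrix (Fin m) (Fin m) ℝ)).det ^ (-(ν / 2)) := by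
    rw [Matrix.det_smul, Matrix.det_one, mul_one, Fintype.card_fin]
    -- Both sides are positive, so taking logarithms reduces the claim to a ring identity in the
    -- logarithms of the factors.
    refine Real.log_injOn_pos (Set.mem_Ioi.mpr (by positivity)) (Set.mem_Ioi.mpr (by positivity)) ?_
    rw [h2π, Real.log_mul (by positivity) (by positivity), Real.log_div one_ne_zero (by positivity),
      Real.log_mul (by positivity) (by positivity), Real.log_mul (by positivity) (by positivity),
      Real.log_rpow hσ, Real.log_rpow (by positivity), Real.log_rpow (by positivity),
      Real.log_rpow (by positivity), Real.log_div (by positivity) (by positivity),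
      Real.log_mul (by positivity) (by positivity), Real.log_mul (by positivity) (by positivity),
      Real.log_mul (by positivity) (by positivity), Real.log_rpow hs,
      Real.log_rpow (by positivity), Real.log_rpow (by positivity), Real.log_rpow hπ,
      Real.log_mul (by positivity) (by positivity), Real.log_mul (by positivity) (by positivity),
      Real.log_pow, Real.log_mul (by positivity) (by positivity), Real.log_exp, Real.log_exp,
      Real.log_pow, Real.log_one]
    push_cast
    ring
  rw [capacityFormula, h]
  ring

theorem lintegral_maxLik {m n : ℕ} {ν σ ρ : ℝ} (hν : (m : ℝ) - 1 < ν) (hν0 : 0 < ν)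
    (hσ : 0 < σ) (hρ : 0 < ρ) :
    ∫⁻ x, ENNReal.ofReal (maxLik (normalModel m n ν σ ρ) x) =
      ENNReal.ofReal (capacityFormula m n ν σ ρ) := by
  simp_rw [maxLik_normalModel_eq_rpow hν0 hσ hρ]
  rw [capacityFormula_eq hν0 hσ hρ, ENNReal.ofReal_mul (Real.exp_pos _).le,
    ← lintegral_det_add_scatter_rpow hν hν0 (by positivity) (PosDef.one.smul (by positivity)) n,
    ← MeasureTheory.lintegral_const_mul' _ _ ENNReal.ofReal_ne_top]
  simp_rw [ENNReal.ofReal_mul (Real.exp_pos _).le]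

theorem maxLik_pos {m n : ℕ} {ν σ ρ : ℝ} (hν : 0 < ν) (hσ : 0 < σ)
    (hρ : 0 < ρ) (x : Fin n → Fin m → ℝ) : 0 < maxLik (normalModel m n ν σ ρ) x := by
  rw [maxLik_normalModel hν hσ hρ, normalDensity_mul_luckiness_map hν hσ hρ]
  exact Real.exp_pos _

theorem measurable_maxLik {m n : ℕ} {ν σ ρ : ℝ} (hν : 0 < ν) (hσ : 0 < σ) (hρ : 0 < ρ) :
    Measurable (maxLik (normalModel m n ν σ ρ)) := by
  rw [funext fun x => maxLik_normalModel_eq_rpow (m := m) (n := n) hν hσ hρ x]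
  exact (measurable_det_add_scatter_rpow _ _ _).const_mul _

theorem integrable_maxLik {m n : ℕ} {ν σ ρ : ℝ} (hν : (m : ℝ) - 1 < ν) (hν0 : 0 < ν)
    (hσ : 0 < σ) (hρ : 0 < ρ) : MeasureTheory.Integrable (maxLik (normalModel m n ν σ ρ)) := by
  refine ⟨(measurable_maxLik hν0 hσ hρ).aestronglyMeasurable, ?_⟩
  rw [MeasureTheory.hasFiniteIntegral_iff_ofReal (.of_forall fun x => (maxLik_pos hν0 hσ hρ x).le),
    lintegral_maxLik hν hν0 hσ hρ]
  exact ENNReal.ofReal_lt_top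

theorem capacityFormula_pos {m n : ℕ} {ν σ ρ : ℝ} (hν : (m : ℝ) - 1 < ν) (hν0 : 0 < ν)
    (hσ : 0 < σ) (hρ : 0 < ρ) : 0 < capacityFormula m n ν σ ρ := by
  have hn : (0 : ℝ) ≤ n := n.cast_nonneg
  have h1 := multiGamma_pos (m := m) (z := ν / 2) (by linarith)
  have h2 := multiGamma_pos (m := m) (z := (n + ν) / 2) (by linarith)
  unfold capacityFormula
  positivity

theorem capacity_normalModel {m n : ℕ} {ν σ ρ : ℝ} (hν : (m : ℝ) - 1 < ν) (hν0 : 0 < ν)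
    (hσ : 0 < σ) (hρ : 0 < ρ) :
    capacity (normalModel m n ν σ ρ) = capacityFormula m n ν σ ρ := by
  rw [capacity, MeasureTheory.integral_eq_lintegral_of_nonneg_ae
    (.of_forall fun x => (maxLik_pos hν0 hσ hρ x).le)
    (measurable_maxLik hν0 hσ hρ).aestronglyMeasurable, lintegral_maxLik hν hν0 hσ hρ,
    ENNReal.toReal_ofReal (capacityFormula_pos hν hν0 hσ hρ).le]

theorem nml_normalModel {m n : ℕ} {ν σ ρ : ℝ} (hν : (m : ℝ) - 1 < ν) (hν0 : 0 < ν)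
    (hσ : 0 < σ) (hρ : 0 < ρ) (x : Fin n → Fin m → ℝ) :
    nml (normalModel m n ν σ ρ) x =
      (ν ^ ν / (Real.pi ^ (n : ℝ) * ((n : ℝ) + ν) ^ ((n : ℝ) + ν) *
          (1 + (n : ℝ) / (ρ ^ 2 * ν)))) ^ ((m : ℝ) / 2) *
        (multiGamma m (((n : ℝ) + ν) / 2) / multiGamma m (ν / 2)) *
        (σ ^ ((m : ℝ) * ν) / (covEst ν σ ρ x).det ^ (((n : ℝ) + ν) / 2)) := by
  have hn : (0 : ℝ) ≤ n := n.cast_nonneg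
  have hs : 0 < (n : ℝ) + ν := by positivity
  have hc : 0 < 1 + (n : ℝ) / (ρ ^ 2 * ν) := by positivity
  have hπ := Real.pi_pos
  have h1 := multiGamma_pos (m := m) (z := ν / 2) (by linarith)
  have h2 := multiGamma_pos (m := m) (z := (n + ν) / 2) (by linarith)
  have hd := (covEst_posDef hν0 hσ hρ x).det_pos
  rw [nml, capacity_normalModel hν hν0 hσ hρ, capacityFormula_eq hν0 hσ hρ,
    maxLik_normalModel hν0 hσ hρ, normalDensity_mul_luckiness_map hν0 hσ hρ,
    Matrix.det_smul, Matrix.det_one, mul_one, Fintype.card_fin]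
  refine Real.log_injOn_pos (Set.mem_Ioi.mpr (by positivity)) (Set.mem_Ioi.mpr (by positivity)) ?_
  generalize (covEst ν σ ρ x).det = D at *
  generalize multiGamma m (ν / 2) = A at *
  generalize multiGamma m ((n + ν) / 2) = B at *
  generalize 1 + (n : ℝ) / (ρ ^ 2 * ν) = C at *
  have h2π : Real.log (2 * Real.pi) = Real.log 2 + Real.log Real.pi :=
    Real.log_mul two_ne_zero hπ.ne'
  have e1 : Real.log ((Real.pi ^ (n : ℝ) * C) ^ ((m : ℝ) / 2) * (A / B) *
      ((ν * σ ^ 2) ^ m) ^ (-(ν / 2))) = m / 2 * (n * Real.log Real.pi + Real.log C) +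
      (Real.log A - Real.log B) - ν / 2 * (m * (Real.log ν + 2 * Real.log σ)) := by
    rw [Real.log_mul (by positivity) (by positivity), Real.log_mul (by positivity) (by positivity),
      Real.log_rpow (by positivity), Real.log_rpow (by positivity),
      Real.log_div (by positivity) (by positivity), Real.log_mul (by positivity) (by positivity),
      Real.log_rpow hπ, Real.log_pow, Real.log_mul (by positivity) (by positivity), Real.log_pow]
    push_cast
    ring
  have e2 : Real.log ((ν ^ ν / (Real.pi ^ (n : ℝ) * ((n : ℝ) + ν) ^ ((n : ℝ) + ν) * C)) ^
      ((m : ℝ) / 2)) = m / 2 * (ν * Real.log ν - (n * Real.log Real.pi +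
        (n + ν) * Real.log (n + ν) + Real.log C)) := by
    rw [Real.log_rpow (by positivity), Real.log_div (by positivity) (by positivity),
      Real.log_mul (by positivity) (by positivity), Real.log_mul (by positivity) (by positivity),
      Real.log_rpow hπ, Real.log_rpow hs, Real.log_rpow hν0]
  rw [h2π, Real.log_div (by positivity) (by positivity), Real.log_exp,
    Real.log_mul (by positivity) (by positivity), Real.log_exp, e1,
    Real.log_mul (by positivity) (by positivity), Real.log_mul (by positivity) (by positivity), e2,
    Real.log_div (by positivity) (by positivity), Real.log_div (by positivity) (by positivity),
    Real.log_rpow hσ, Real.log_rpow hd]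
  ring

/-! ### Dimension zero -/

theorem normalDensity_fin_zero {n : ℕ} (μ : Fin 0 → ℝ) (S : Matrix (Fin 0) (Fin 0) ℝ)
    (x : Fin n → Fin 0 → ℝ) : normalDensity μ S x = 1 := by
  simp [normalDensity]

theorem luckiness_fin_zero (ν σ ρ : ℝ) (μ : Fin 0 → ℝ) (S : Matrix (Fin 0) (Fin 0) ℝ) :
    luckiness ν σ ρ μ S = 1 := by
  simp [luckiness, Matrix.trace]

theorem normalModel_fin_zero (n : ℕ) (ν σ ρ : ℝ) : normalModel 0 n ν σ ρ = {fun _ => 1} := by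
  ext p
  simp only [normalModel, normalDensity_fin_zero, luckiness_fin_zero, mul_one, Set.mem_ofPred_eq,
    Set.mem_singleton_iff]
  exact ⟨fun ⟨_, _, _, h⟩ => h, fun h => ⟨0, 1, PosDef.one, h⟩⟩

theorem maxLik_fin_zero (n : ℕ) (ν σ ρ : ℝ) : maxLik (normalModel 0 n ν σ ρ) = fun _ => 1 := by
  ext x
  simp [maxLik, normalModel_fin_zero]

theorem volume_univ_fin_zero (n : ℕ) :
    (MeasureTheory.volume (Set.univ : Set (Fin n → Fin 0 → ℝ))) = 1 := by
  rw [MeasureTheory.volume_pi, MeasureTheory.Measure.pi_univ]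
  simp [MeasureTheory.volume_pi]

theorem capacity_fin_zero (n : ℕ) (ν σ ρ : ℝ) : capacity (normalModel 0 n ν σ ρ) = 1 := by
  simp [capacity, maxLik_fin_zero, MeasureTheory.Measure.real, volume_univ_fin_zero]

theorem capacityFormula_fin_zero (n : ℕ) (ν σ ρ : ℝ) : capacityFormula 0 n ν σ ρ = 1 := by
  simp [capacityFormula, multiGamma]

theorem integrable_maxLik_fin_zero (n : ℕ) (ν σ ρ : ℝ) :
    MeasureTheory.Integrable (maxLik (normalModel 0 n ν σ ρ)) := by
  rw [maxLik_fin_zero]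
  exact MeasureTheory.integrable_const_iff.mpr <| .inr
    ⟨by rw [volume_univ_fin_zero]; exact ENNReal.one_lt_top⟩

end LNML

end

theorem theorem1 (m n : ℕ) (ν σ ρ : ℝ) (hν : (m : ℝ) - 1 < ν) (hσ : 0 < σ) (hρ : 0 < ρ) :
    -- `meanEst`, `covEst` are the MAP estimates: the unique maximizers of density times luckiness
    (∀ x : Fin n → Fin m → ℝ, (LNML.covEst ν σ ρ x).PosDef ∧
      ∀ (μ : Fin m → ℝ) (S : Matrix (Fin m) (Fin m) ℝ), S.PosDef →
        (μ, S) ≠ (LNML.meanEst ν ρ x, LNML.covEst ν σ ρ x) →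
        LNML.normalDensity μ S x * LNML.luckiness ν σ ρ μ S <
          LNML.normalDensity (LNML.meanEst ν ρ x) (LNML.covEst ν σ ρ x) x *
            LNML.luckiness ν σ ρ (LNML.meanEst ν ρ x) (LNML.covEst ν σ ρ x)) ∧
    -- the maximum over the model exists at every sample, and is integrable
    (∀ x : Fin n → Fin m → ℝ,
      IsGreatest ((fun p : (Fin n → Fin m → ℝ) → ℝ => p x) '' LNML.normalModel m n ν σ ρ)
        (LNML.maxLik (LNML.normalModel m n ν σ ρ) x)) ∧
    MeasureTheory.Integrable (LNML.maxLik (LNML.normalModel m n ν σ ρ)) ∧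
    -- the capacity
    LNML.capacity (LNML.normalModel m n ν σ ρ) = LNML.capacityFormula m n ν σ ρ ∧
    -- the LNML density
    ∀ x : Fin n → Fin m → ℝ,
      LNML.nml (LNML.normalModel m n ν σ ρ) x =
        LNML.normalDensity (LNML.meanEst ν ρ x) (LNML.covEst ν σ ρ x) x *
          LNML.luckiness ν σ ρ (LNML.meanEst ν ρ x) (LNML.covEst ν σ ρ x) /
          LNML.capacityFormula m n ν σ ρ ∧
      LNML.nml (LNML.normalModel m n ν σ ρ) x =
        (ν ^ ν / (Real.pi ^ (n : ℝ) * ((n : ℝ) + ν) ^ ((n : ℝ) + ν) *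
            (1 + (n : ℝ) / (ρ ^ 2 * ν)))) ^ ((m : ℝ) / 2) *
          (LNML.multiGamma m (((n : ℝ) + ν) / 2) / LNML.multiGamma m (ν / 2)) *
          (σ ^ ((m : ℝ) * ν) / (LNML.covEst ν σ ρ x).det ^ (((n : ℝ) + ν) / 2)) := by
  -- For `m = 0` the bound on `ν` only says `-1 < ν`, so the argument based on `0 < ν` fails; there
  -- the sample space is a point of volume one and the model is the constant 1.
  rcases Nat.eq_zero_or_pos m with rfl | hm
  · refine ⟨fun x => ⟨?_, fun μ S _ h => (h (Subsingleton.elim _ _)).elim⟩, fun x => ?_,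
      LNML.integrable_maxLik_fin_zero n ν σ ρ, ?_, fun x => ⟨?_, ?_⟩⟩
    · rw [Subsingleton.elim (LNML.covEst ν σ ρ x) 1]
      exact Matrix.PosDef.one
    · rw [LNML.maxLik_fin_zero, LNML.normalModel_fin_zero, Set.image_singleton]
      exact isGreatest_singleton
    · rw [LNML.capacity_fin_zero, LNML.capacityFormula_fin_zero]
    · simp [LNML.nml, LNML.maxLik_fin_zero, LNML.capacity_fin_zero,
        LNML.normalDensity_fin_zero, LNML.luckiness_fin_zero, LNML.capacityFormula_fin_zero]
    · simp [LNML.nml, LNML.maxLik_fin_zero, LNML.capacity_fin_zero, LNML.multiGamma]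
  · have hν0 : 0 < ν := by
      have : (1 : ℝ) ≤ m := by exact_mod_cast hm
      linarith
    refine ⟨fun x => ⟨LNML.covEst_posDef hν0 hσ hρ x, fun μ S hS h =>
      LNML.normalDensity_mul_luckiness_lt hν0 hσ hρ x μ hS h⟩, fun x => ?_,
      LNML.integrable_maxLik hν hν0 hσ hρ, LNML.capacity_normalModel hν hν0 hσ hρ,
      fun x => ⟨?_, LNML.nml_normalModel hν hν0 hσ hρ x⟩⟩
    · rw [LNML.maxLik_normalModel hν0 hσ hρ]
      exact LNML.isGreatest_normalModel hν0 hσ hρ x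
    · rw [LNML.nml, LNML.maxLik_normalModel hν0 hσ hρ, LNML.capacity_normalModel hν hν0 hσ hρ]
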